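/- Theorem. Let $d,\tilde d,m,M,k$ be nonnegative integers with $d\ge 8$ and $1\le\tilde d\le d$, and let $C\ge 1$ and $0<\beta,\gamma\le 1$ be real numbers. Consider the following Orthogonal Subspace Game in $\mathbb{R}^d$ (with the Euclidean norm). (1) The oracle samples a uniform $\tilde d$-dimensional linear subspace $E$ of $\mathbb{R}^d$ (normalized Haar measure on the Grassmannian) and, given $E$, i.i.d. vectors $v_1,\dots,v_m$ uniform on the unit sphere of $E$. (2) The player observes $E$ and $v_1,\dots,v_m$ and stores an $M$-bit message $\mathsf{Message}\in\{0,1\}^M$ about these. (3) Based on $\mathsf{Message}$ and $v_1,\dots,v_m$ only, the player returns unit vectors $y_1,\dots,y_k\in\mathbb{R}^d$. The player may be randomized: the message and output functions are measurable and may both use an internal random seed that is independent of $(E,v_1,\dots,v_m)$. The player wins if for every $i\in\{1,\dots,k\}$ $$\|\mathrm{Proj}_E(y_i)\|\le\beta\quad\text{and}\quad \|\mathrm{Proj}_{\mathrm{Span}(y_1,\dots,y_{i-1})^\perp}(y_i)\|\ge\gamma ,$$ where $\mathrm{Proj}$ denotes orthogonal projection. Assume that $$\frac{\gamma}{\beta}\ge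 12\sqrt{\frac{kd}{\tilde d}}\qquad\text{and}\qquad \frac{\tilde d}{4}\ge k\ge 50\,C\,\frac{M+2}{\tilde d}\,\ln\frac{\sqrt d}{\gamma}.$$ If the player wins the game with probability at least $1/C$, then $m\ge \tilde d/2$. -/

import Mathlib

open MeasureTheory
open scoped ENNReal

noncomputable section

namespace OrthogonalSubspaceGame

/-- `ℝ^d` with the Euclidean norm. -/
abbrev Vec (d : ℕ) : Type := EuclideanSpace ℝ (Fin d)

/-- The Grassmannian `Gr_n(ℝ^d)`: the `n`-dimensional linear subspaces of `ℝ^d`. -/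
def Gr (d n : ℕ) : Type := {E : Submodule ℝ (Vec d) // Module.finrank ℝ E = n}

/-- The usual topology of the Grassmannian: subspaces are identified with their orthogonal
projections. -/
instance (d n : ℕ) : TopologicalSpace (Gr d n) :=
  TopologicalSpace.induced (fun E : Gr d n => E.1.starProjection) inferInstance

/-- The Grassmannian carries its Borel σ-algebra. -/
instance (d n : ℕ) : MeasurableSpace (Gr d n) := borel (Gr d n)

instance (d n : ℕ) : BorelSpace (Gr d n) := ⟨rfl⟩

/-- The orthogonal group `O(d)`: the linear maps `U` of `ℝ^d` with `Uᵀ U = U Uᵀ = 1`. -/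
abbrev Orth (d : ℕ) : Type := unitary (Vec d →L[ℝ] Vec d)

instance (d : ℕ) : ContinuousStar (Vec d →L[ℝ] Vec d) :=
  ⟨(ContinuousLinearMap.adjoint (𝕜 := ℝ) (E := Vec d) (F := Vec d)).continuous⟩

instance (d : ℕ) : CompactSpace (Orth d) := by
  have hc : IsCompact ((unitary (Vec d →L[ℝ] Vec d) : Set (Vec d →L[ℝ] Vec d))) := by
    refine Metric.isCompact_of_isClosed_isBounded isClosed_unitary ?_
    refine (Metric.isBounded_closedBall (x := (0 : Vec d →L[ℝ] Vec d)) (r := 1)).subset ?_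
    intro u hu
    rw [mem_closedBall_zero_iff]
    refine ContinuousLinearMap.opNorm_le_bound _ zero_le_one fun x => ?_
    rw [one_mul]
    exact le_of_eq ((Unitary.linearIsometryEquiv ⟨u, hu⟩).norm_map x)
  exact isCompact_iff_compactSpace.mp hc

/-- The normalized Haar measure of the orthogonal group (total mass one). -/
def haarOrth (d : ℕ) : Measure (Orth d) := Measure.haarMeasure ⊤

instance (d : ℕ) : IsProbabilityMeasure (haarOrth d) :=
  ⟨by simpa [haarOrth] using
    Measure.haarMeasure_self (K₀ := (⊤ : TopologicalSpace.PositiveCompacts (Orth d)))⟩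

/-- The image of a subspace under an orthogonal map. -/
def rotate {d n : ℕ} (U : Orth d) (E : Gr d n) : Gr d n :=
  ⟨E.1.map (Unitary.linearIsometryEquiv U).toLinearEquiv.toLinearMap,
    (LinearEquiv.finrank_map_eq (Unitary.linearIsometryEquiv U).toLinearEquiv E.1).trans E.2⟩

theorem continuous_rotate {d n : ℕ} (E : Gr d n) : Continuous fun U : Orth d => rotate U E := by
  refine continuous_induced_rng.2 ?_
  have h : (fun U : Orth d => (rotate U E).1.starProjection) =
      fun U : Orth d => (U : Vec d →L[ℝ] Vec d) * E.1.starProjection *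
        star (U : Vec d →L[ℝ] Vec d) := by
    funext U
    ext1 x
    exact Submodule.starProjection_map_apply (Unitary.linearIsometryEquiv U) E.1 x
  refine (congrArg Continuous h).mpr ?_
  fun_prop

/-- The span of the first `n` vectors of the standard basis of `ℝ^d`. -/
def baseSubspace {d n : ℕ} (h : n ≤ d) : Gr d n :=
  ⟨Submodule.span ℝ (Set.range fun i : Fin n => EuclideanSpace.basisFun (Fin d) ℝ (Fin.castLE h i)),
    by
      have hli : LinearIndependent ℝ
          (fun i : Fin n => EuclideanSpace.basisFun (Fin d) ℝ (Fin.castLE h i)) :=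
        (EuclideanSpace.basisFun (Fin d) ℝ).orthonormal.linearIndependent.comp _
          (Fin.castLE_injective h)
      simpa using finrank_span_eq_card hli⟩

/-- The law of a uniform `n`-dimensional subspace of `ℝ^d`: the normalized Haar measure of the
Grassmannian, i.e. the law of `U E₀` for a Haar-distributed orthogonal `U` and a fixed `E₀`. -/
def uniformSubspace {d n : ℕ} (h : n ≤ d) : Measure (Gr d n) :=
  (haarOrth d).map fun U => rotate U (baseSubspace h)

instance {d n : ℕ} (h : n ≤ d) : IsProbabilityMeasure (uniformSubspace h) :=
  Measure.isProbabilityMeasure_map (continuous_rotate _).measurable.aemeasurable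

/-- The uniform distribution on the unit sphere of a subspace `E`: the normalized surface measure,
seen as a measure on `ℝ^d`. -/
def uniformSphere {d : ℕ} (E : Submodule ℝ (Vec d)) : Measure (Vec d) :=
  let σ : Measure (Metric.sphere (0 : E) 1) := (volume : Measure E).toSphere
  ((σ Set.univ)⁻¹ • σ).map fun x : Metric.sphere (0 : E) 1 => (x.1 : Vec d)

theorem isProbabilityMeasure_uniformSphere {d : ℕ} {E : Submodule ℝ (Vec d)} (h : E ≠ ⊥) :
    IsProbabilityMeasure (uniformSphere E) := by
  have : Nontrivial E := (Submodule.nontrivial_iff_ne_bot).2 h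
  have : IsProbabilityMeasure
      (((volume : Measure E).toSphere Set.univ)⁻¹ • (volume : Measure E).toSphere) :=
    ⟨by
      rw [Measure.smul_apply, smul_eq_mul]
      exact ENNReal.inv_mul_cancel
        (Measure.measure_univ_ne_zero.2 (Measure.toSphere_ne_zero (volume : Measure E)))
        (measure_ne_top _ _)⟩
  exact Measure.isProbabilityMeasure_map (by fun_prop)

/-- A strategy of the player, with internal randomness `ω` drawn from a probability space `Ω`
independently of the oracle. The message is a function of `ω`, the hidden subspace and the samples;
the output is a function of `ω`, the `M`-bit message and the samples only. -/
structure Strategy (Ω : Type*) [MeasurableSpace Ω] (d n m M k : ℕ) where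
  message : Ω → Gr d n → (Fin m → Vec d) → (Fin M → Bool)
  measurable_message :
    Measurable fun p : Ω × Gr d n × (Fin m → Vec d) => message p.1 p.2.1 p.2.2
  output : Ω → (Fin M → Bool) → (Fin m → Vec d) → (Fin k → Vec d)
  measurable_output :
    Measurable fun p : Ω × (Fin M → Bool) × (Fin m → Vec d) => output p.1 p.2.1 p.2.2
  norm_output : ∀ ω msg v i, ‖output ω msg v i‖ = 1

/-- The winning condition: every `y i` is `β`-nearly orthogonal to `E`, and the component of `y i`
orthogonal to the preceding vectors has norm at least `γ`. -/
def Wins {d k : ℕ} (β γ : ℝ) (E : Submodule ℝ (Vec d)) (y : Fin k → Vec d) : Prop :=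
  ∀ i, ‖E.starProjection (y i)‖ ≤ β ∧
    γ ≤ ‖(Submodule.span ℝ (y '' {j | j < i}))ᗮ.starProjection (y i)‖

/-- The probability that the player wins: `ω` is drawn from `P`, independently `E` is drawn
uniformly, and given `E` the samples `v` are i.i.d. uniform on the unit sphere of `E`. -/
def winProb {Ω : Type*} [MeasurableSpace Ω] (P : Measure Ω) {d n m M k : ℕ} (h : n ≤ d)
    (S : Strategy Ω d n m M k) (β γ : ℝ) : ℝ≥0∞ :=
  ∫⁻ ω, ∫⁻ E, (Measure.pi fun _ : Fin m => uniformSphere E.1)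
    {v | Wins β γ E.1 (S.output ω (S.message ω E v) v)} ∂(uniformSubspace h) ∂P

end OrthogonalSubspaceGame

end

/-!
Write `n` for the dimension of `E` and suppose that there are at most `n / 2` samples. Their span
`W` leaves room for an orthonormal family `x` of at least `n / 2` vectors in `E ∩ Wᗮ`. Test the
answer `y` of a player who ignores the message against a family `G` of as many independent standard
Gaussian vectors, and let `overlap G y` be the sum of the squares of all inner products.

* Anti-concentration: if every `y i` has distance at least `γ` to the span of its predecessors, then
  resampling `G` along one new direction per `y i` bounds the mean of `exp (-μ * overlap G y)` by
  `(2 μ γ²) ^ (-k r / 2)`, where `r` is the number of test vectors.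
* Given the samples, the law of `E` is invariant under the rotations that fix `W`. By polar
  decomposition, one of them, depending on `G`, makes the map `x j ↦ G j` (after projection to `Wᗮ`)
  symmetric, so that the overlap is controlled by the projections of `y` to `W` and to the span of
  `x`, which are both contained in `E`. If all projections of `y` to `E` have norm at most `β`, the
  rotated overlap has mean at most `4 k d β²`, so by Jensen's inequality the mean of its
  exponential `exp (-μ * overlap)` is at least `exp (-4 μ k d β²)`.

Comparing the two bounds for a suitable `μ`, the player wins with probability at most
`exp (-k n / 4)`. A union bound over the `2 ^ M` messages accounts for the message.
-/

open ProbabilityTheory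
open scoped InnerProductSpace

namespace OrthogonalSubspaceGame

theorem lintegral_exp_neg_mul_sq_gaussianReal_le {μ c : ℝ} (hμ : 0 < μ) (hc : c ≠ 0) (a : ℝ) :
    ∫⁻ t, ENNReal.ofReal (Real.exp (-(μ * (a + c * t) ^ 2))) ∂gaussianReal 0 1 ≤
      ENNReal.ofReal (√(2 * μ * c ^ 2))⁻¹ := by
  have hμc : 0 < μ * c ^ 2 := by positivity
  have hshift : ∀ t, Real.exp (-(μ * (a + c * t) ^ 2)) =
      Real.exp (-(μ * c ^ 2) * (t + a / c) ^ 2) := fun t => by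
    congr 1; field_simp; ring
  have hint : Integrable fun t => Real.exp (-(μ * (a + c * t) ^ 2)) := by
    simp only [hshift]
    exact (integrable_exp_neg_mul_sq hμc).comp_add_right (a / c)
  have hlebesgue : ∫ t, Real.exp (-(μ * (a + c * t) ^ 2)) = √(Real.pi / (μ * c ^ 2)) := by
    simp only [hshift]
    rw [integral_add_right_eq_self (fun t => Real.exp (-(μ * c ^ 2) * t ^ 2)) (a / c),
      integral_gaussian]
  have hdensity : ∀ t, gaussianPDF 0 1 t ≤ ENNReal.ofReal (√(2 * Real.pi))⁻¹ := fun t => by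
    refine ENNReal.ofReal_le_ofReal ?_
    simp only [gaussianPDFReal, NNReal.coe_one, mul_one, neg_div]
    exact mul_le_of_le_one_right (by positivity)
      (Real.exp_le_one_iff.2 (neg_nonpos.2 (by positivity)))
  rw [gaussianReal_of_var_ne_zero _ one_ne_zero,
    lintegral_withDensity_eq_lintegral_mul _ (measurable_gaussianPDF _ _) (by fun_prop)]
  calc ∫⁻ t, gaussianPDF 0 1 t * ENNReal.ofReal (Real.exp (-(μ * (a + c * t) ^ 2)))
      ≤ ∫⁻ t, ENNReal.ofReal (√(2 * Real.pi))⁻¹ *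
          ENNReal.ofReal (Real.exp (-(μ * (a + c * t) ^ 2))) :=
        lintegral_mono fun t => mul_le_mul_left (hdensity t) _
    _ = ENNReal.ofReal ((√(2 * Real.pi))⁻¹ * √(Real.pi / (μ * c ^ 2))) := by
        rw [lintegral_const_mul _ (by fun_prop), ← ofReal_integral_eq_lintegral_ofReal hint
          (.of_forall fun t => (Real.exp_pos _).le), hlebesgue, ENNReal.ofReal_mul (by positivity)]
    _ = ENNReal.ofReal (√(2 * μ * c ^ 2))⁻¹ := by
        rw [← Real.sqrt_inv, ← Real.sqrt_inv, ← Real.sqrt_mul (by positivity)]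
        congr 2
        field_simp

/-- A family of vectors is `γ`-robustly linearly independent if every vector has distance at least
`γ` to the span of the preceding ones. The distance is spelled out pointwise, without projections,
so that the notion makes sense in any normed space. -/
def RobustlyIndependent {ι V : Type*} [Preorder ι] [NormedAddCommGroup V] [NormedSpace ℝ V]
    (γ : ℝ) (y : ι → V) : Prop :=
  ∀ i, ∀ x ∈ Submodule.span ℝ (y '' Set.Iio i), γ ≤ ‖y i - x‖

section Gaussian

variable {V : Type*} [NormedAddCommGroup V] [InnerProductSpace ℝ V] [FiniteDimensional ℝ V]

theorem RobustlyIndependent.exists_unit_orthogonal_span {ι : Type*} [Preorder ι] {γ : ℝ}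
    {y : ι → V} (hy : RobustlyIndependent γ y) (hγ : 0 < γ) {s : Set ι} {i : ι}
    (hs : ∀ j ∈ s, j < i) :
    ∃ e : V, ‖e‖ = 1 ∧ (∀ j ∈ s, ⟪e, y j⟫_ℝ = 0) ∧ γ ≤ ⟪e, y i⟫_ℝ := by
  set S := Submodule.span ℝ (y '' s)
  set v := y i - S.starProjection (y i)
  have hv : γ ≤ ‖v‖ := hy i _
    (Submodule.span_mono (Set.image_mono hs) (Submodule.starProjection_apply_mem S (y i)))
  have hv0 : ‖v‖ ≠ 0 := (hγ.trans_le hv).ne'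
  have hvS : ∀ x ∈ S, ⟪v, x⟫_ℝ = 0 := fun x hx =>
    Submodule.starProjection_inner_eq_zero (y i) x hx
  refine ⟨‖v‖⁻¹ • v, ?_, fun j hj => ?_, ?_⟩
  · rw [norm_smul, norm_inv, norm_norm, inv_mul_cancel₀ hv0]
  · rw [real_inner_smul_left, hvS _ (Submodule.subset_span ⟨j, hj, rfl⟩), mul_zero]
  · have hvy : ⟪v, y i⟫_ℝ = ‖v‖ ^ 2 := by
      rw [← real_inner_self_eq_norm_sq, ← sub_eq_zero, ← inner_sub_right, sub_sub_cancel]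
      exact hvS _ (Submodule.starProjection_apply_mem S (y i))
    rwa [real_inner_smul_left, hvy, sq, inv_mul_cancel_left₀ hv0]

variable [MeasurableSpace V] [BorelSpace V]

theorem map_resample_stdGaussian {e : V} (he : ‖e‖ = 1) :
    ((stdGaussian V).prod (gaussianReal 0 1)).map (fun p => p.1 + (p.2 - ⟪e, p.1⟫_ℝ) • e) =
      stdGaussian V := by
  have : IsProbabilityMeasure
      (((stdGaussian V).prod (gaussianReal 0 1)).map fun p => p.1 + (p.2 - ⟪e, p.1⟫_ℝ) • e) :=
    Measure.isProbabilityMeasure_map (by fun_prop)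
  refine Measure.ext_of_charFun (funext fun x => ?_)
  set x' : V := x - ⟪e, x⟫_ℝ • e
  have hinner : ∀ p : V × ℝ, ⟪p.1 + (p.2 - ⟪e, p.1⟫_ℝ) • e, x⟫_ℝ =
      ⟪p.1, x'⟫_ℝ + ⟪p.2, ⟪e, x⟫_ℝ⟫_ℝ := fun p => by
    simp only [x', inner_add_left, inner_sub_right, real_inner_smul_left, real_inner_smul_right,
      real_inner_comm e p.1, RCLike.inner_apply]
    simp only [Real.ringHom_apply]
    ring
  have hnorm : ‖x‖ ^ 2 = ‖x'‖ ^ 2 + ⟪e, x⟫_ℝ ^ 2 := by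
    rw [norm_sub_sq_real, norm_smul, he, real_inner_smul_right, real_inner_comm e x, mul_one,
      Real.norm_eq_abs, sq_abs]
    ring
  calc charFun _ x = ∫ p : V × ℝ, Complex.exp (⟪p.1, x'⟫_ℝ * Complex.I) *
        Complex.exp (⟪p.2, ⟪e, x⟫_ℝ⟫_ℝ * Complex.I) ∂(stdGaussian V).prod (gaussianReal 0 1) := by
        rw [charFun_apply, integral_map (by fun_prop) (by fun_prop)]
        simp only [hinner, Complex.ofReal_add, add_mul, Complex.exp_add]
    _ = charFun (stdGaussian V) x' * charFun (gaussianReal 0 1) ⟪e, x⟫_ℝ := by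
        rw [charFun_apply, charFun_apply]
        exact integral_prod_mul (fun g : V => Complex.exp (⟪g, x'⟫_ℝ * Complex.I))
          fun t : ℝ => Complex.exp (⟪t, ⟪e, x⟫_ℝ⟫_ℝ * Complex.I)
    _ = charFun (stdGaussian V) x := by
        rw [charFun_stdGaussian, charFun_stdGaussian, charFun_gaussianReal, ← Complex.exp_add]
        congr 1
        rw [← Complex.ofReal_pow ‖x‖, hnorm]
        push_cast
        ring

theorem lintegral_stdGaussian_eq_resample {e : V} (he : ‖e‖ = 1) {f : V → ℝ≥0∞}
    (hf : Measurable f) :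
    ∫⁻ g, f g ∂stdGaussian V =
      ∫⁻ g, ∫⁻ t, f (g + (t - ⟪e, g⟫_ℝ) • e) ∂gaussianReal 0 1 ∂stdGaussian V := by
  conv_lhs => rw [← map_resample_stdGaussian he]
  rw [lintegral_map hf (by fun_prop), lintegral_prod _ (by fun_prop)]

theorem RobustlyIndependent.lintegral_stdGaussian_exp_neg_le {ι : Type*} [LinearOrder ι]
    {γ μ : ℝ} {y : ι → V} (hy : RobustlyIndependent γ y) (hγ : 0 < γ) (hμ : 0 < μ)
    (s : Finset ι) :
    ∫⁻ g, ENNReal.ofReal (Real.exp (-(μ * ∑ i ∈ s, ⟪g, y i⟫_ℝ ^ 2))) ∂stdGaussian V ≤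
      ENNReal.ofReal (√(2 * μ * γ ^ 2))⁻¹ ^ s.card := by
  induction s using Finset.induction_on_max with
  | empty => simp
  | insert a s hs ih =>
    have ha : a ∉ s := fun h => lt_irrefl _ (hs a h)
    obtain ⟨e, he, hes, hea⟩ := hy.exists_unit_orthogonal_span hγ (s := s) hs
    let Q : V → ℝ≥0∞ := fun g => ENNReal.ofReal (Real.exp (-(μ * ∑ i ∈ s, ⟪g, y i⟫_ℝ ^ 2)))
    have hsplit : ∀ (g : V) (t : ℝ), ENNReal.ofReal (Real.exp (-(μ *
        ∑ i ∈ insert a s, ⟪g + (t - ⟪e, g⟫_ℝ) • e, y i⟫_ℝ ^ 2))) =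
        Q g * ENNReal.ofReal (Real.exp (-(μ *
          (⟪g, y a⟫_ℝ - ⟪e, g⟫_ℝ * ⟪e, y a⟫_ℝ + ⟪e, y a⟫_ℝ * t) ^ 2))) := fun g t => by
      have hrest : ∀ i ∈ s, ⟪g + (t - ⟪e, g⟫_ℝ) • e, y i⟫_ℝ = ⟪g, y i⟫_ℝ := fun i hi => by
        rw [inner_add_left, real_inner_smul_left, hes i hi, mul_zero, add_zero]
      rw [← ENNReal.ofReal_mul (Real.exp_pos _).le, ← Real.exp_add, Finset.sum_insert ha,
        Finset.sum_congr rfl fun i hi => by rw [hrest i hi], inner_add_left, real_inner_smul_left]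
      congr 2
      ring
    have hlast : ∀ g, ∫⁻ t, ENNReal.ofReal (Real.exp (-(μ *
        (⟪g, y a⟫_ℝ - ⟪e, g⟫_ℝ * ⟪e, y a⟫_ℝ + ⟪e, y a⟫_ℝ * t) ^ 2))) ∂gaussianReal 0 1 ≤
        ENNReal.ofReal (√(2 * μ * γ ^ 2))⁻¹ := fun g =>
      (lintegral_exp_neg_mul_sq_gaussianReal_le hμ (hγ.trans_le hea).ne' _).trans
        (ENNReal.ofReal_le_ofReal (by gcongr))
    rw [lintegral_stdGaussian_eq_resample he (by fun_prop), Finset.card_insert_of_notMem ha,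
      pow_succ]
    calc ∫⁻ g, ∫⁻ t, ENNReal.ofReal (Real.exp (-(μ *
          ∑ i ∈ insert a s, ⟪g + (t - ⟪e, g⟫_ℝ) • e, y i⟫_ℝ ^ 2))) ∂gaussianReal 0 1 ∂stdGaussian V
        ≤ ∫⁻ g, Q g * ENNReal.ofReal (√(2 * μ * γ ^ 2))⁻¹ ∂stdGaussian V :=
          lintegral_mono fun g => by
            simp only [hsplit]
            rw [lintegral_const_mul _ (by fun_prop)]
            gcongr
            exact hlast g
      _ ≤ ENNReal.ofReal (√(2 * μ * γ ^ 2))⁻¹ ^ s.card * ENNReal.ofReal (√(2 * μ * γ ^ 2))⁻¹ := by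
          rw [lintegral_mul_const _ (by fun_prop)]
          gcongr

end Gaussian

theorem ofReal_exp_neg_integral_le_lintegral {Ω : Type*} [MeasurableSpace Ω] {P : Measure Ω}
    [IsProbabilityMeasure P] {X : Ω → ℝ} (hX : Integrable X P) :
    ENNReal.ofReal (Real.exp (-∫ ω, X ω ∂P)) ≤ ∫⁻ ω, ENNReal.ofReal (Real.exp (-X ω)) ∂P := by
  have hnonneg : 0 ≤ᵐ[P] fun ω => Real.exp (-X ω) := .of_forall fun ω => (Real.exp_pos _).le
  by_cases hexp : Integrable (fun ω => Real.exp (-X ω)) P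
  · rw [← ofReal_integral_eq_lintegral_ofReal hexp hnonneg, ← integral_neg]
    exact ENNReal.ofReal_le_ofReal (convexOn_exp.map_integral_le Real.continuous_exp.continuousOn
      isClosed_univ (.of_forall fun ω => Set.mem_univ _) hX.neg hexp)
  · have hmeas : AEStronglyMeasurable (fun ω => Real.exp (-X ω)) P :=
      Real.continuous_exp.comp_aestronglyMeasurable hX.aestronglyMeasurable.neg
    have htop : ∫⁻ ω, ENNReal.ofReal (Real.exp (-X ω)) ∂P = ⊤ := by
      rw [← not_ne_iff, ← lt_top_iff_ne_top, ← hasFiniteIntegral_iff_ofReal hnonneg]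
      exact fun h => hexp ⟨hmeas, h⟩
    exact htop ▸ le_top

section GaussianFamily

variable {J V : Type*} [Fintype J] [NormedAddCommGroup V] [InnerProductSpace ℝ V]

theorem norm_sq_sum_smul_eq_sum_sq {κ : Type*} [Fintype κ] (b : OrthonormalBasis κ ℝ V) (η : J → ℝ)
    (G : J → V) :
    ‖∑ j, η j • G j‖ ^ 2 = ∑ p, (∑ j, ⟪η j • b p, G j⟫_ℝ) ^ 2 := by
  simp only [← b.sum_sq_inner_right, inner_sum, real_inner_smul_left, real_inner_smul_right]

variable [FiniteDimensional ℝ V] [MeasurableSpace V] [BorelSpace V]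

variable (J V) in
/-- The law of a family of independent standard Gaussian vectors of `V` indexed by `J`. -/
noncomputable abbrev gaussianFamily : Measure (J → V) :=
  Measure.pi fun _ : J => stdGaussian V

theorem memLp_inner_gaussianFamily (c : V) (j : J) :
    MemLp (fun G : J → V => ⟪c, G j⟫_ℝ) 2 (gaussianFamily J V) :=
  (IsGaussian.memLp_dual (stdGaussian V) (innerSL ℝ c) 2 (by simp)).comp_measurePreserving
    (measurePreserving_eval _ j)

theorem integrable_sq_sum_inner (c : J → V) :
    Integrable (fun G : J → V => (∑ j, ⟪c j, G j⟫_ℝ) ^ 2) (gaussianFamily J V) :=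
  (memLp_finsetSum _ fun j _ => memLp_inner_gaussianFamily (c j) j).integrable_sq

theorem integral_sum_inner (c : J → V) :
    ∫ G : J → V, ∑ j, ⟪c j, G j⟫_ℝ ∂gaussianFamily J V = 0 := by
  rw [integral_finsetSum _ fun j _ => (memLp_inner_gaussianFamily (c j) j).integrable (by simp)]
  refine Finset.sum_eq_zero fun j _ => ?_
  rw [integral_comp_eval (μ := fun _ : J => stdGaussian V) (f := fun g => ⟪c j, g⟫_ℝ) (by fun_prop)]
  exact integral_strongDual_stdGaussian (innerSL ℝ (c j))

theorem integral_sq_sum_inner (c : J → V) :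
    ∫ G : J → V, (∑ j, ⟪c j, G j⟫_ℝ) ^ 2 ∂gaussianFamily J V = ∑ j, ‖c j‖ ^ 2 := by
  have hvar := variance_sum_pi (μ := fun _ : J => stdGaussian V) (X := fun j => innerSL ℝ (c j))
    fun j => IsGaussian.memLp_dual (stdGaussian V) (innerSL ℝ (c j)) 2 (by simp)
  have hsum : (∑ j, fun G : J → V => innerSL ℝ (c j) (G j)) = fun G => ∑ j, ⟪c j, G j⟫_ℝ := by
    ext G; simp
  rw [hsum, variance_of_integral_eq_zero ((memLp_finsetSum _ fun j _ =>
    memLp_inner_gaussianFamily (c j) j).aemeasurable) (integral_sum_inner c)] at hvar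
  simpa only [variance_dual_stdGaussian, innerSL_apply_norm] using hvar

theorem integral_sq_inner (j : J) (u : V) :
    ∫ G : J → V, ⟪G j, u⟫_ℝ ^ 2 ∂gaussianFamily J V = ‖u‖ ^ 2 := by
  classical
  have hsingle : ∀ G : J → V, ∑ i, ⟪(Pi.single j u : J → V) i, G i⟫_ℝ = ⟪G j, u⟫_ℝ := fun G => by
    rw [Finset.sum_eq_single_of_mem j (Finset.mem_univ j) fun i _ hij => by
      rw [Pi.single_eq_of_ne hij, inner_zero_left], Pi.single_eq_same, real_inner_comm]
  have hnorm : ∑ i, ‖(Pi.single j u : J → V) i‖ ^ 2 = ‖u‖ ^ 2 := by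
    rw [Finset.sum_eq_single_of_mem j (Finset.mem_univ j) fun i _ hij => by
      rw [Pi.single_eq_of_ne hij, norm_zero, zero_pow two_ne_zero], Pi.single_eq_same]
  simpa only [hsingle, hnorm] using integral_sq_sum_inner (Pi.single j u : J → V)

theorem integrable_sq_inner (j : J) (u : V) :
    Integrable (fun G : J → V => ⟪G j, u⟫_ℝ ^ 2) (gaussianFamily J V) := by
  simpa only [real_inner_comm] using (memLp_inner_gaussianFamily u j).integrable_sq

theorem integrable_norm_sq_sum_smul (η : J → ℝ) :
    Integrable (fun G : J → V => ‖∑ j, η j • G j‖ ^ 2) (gaussianFamily J V) := by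
  simp only [norm_sq_sum_smul_eq_sum_sq (stdOrthonormalBasis ℝ V)]
  exact integrable_finsetSum _ fun p _ => integrable_sq_sum_inner _

theorem integral_norm_sq_sum_smul (η : J → ℝ) :
    ∫ G : J → V, ‖∑ j, η j • G j‖ ^ 2 ∂gaussianFamily J V =
      Module.finrank ℝ V * ∑ j, η j ^ 2 := by
  simp only [norm_sq_sum_smul_eq_sum_sq (stdOrthonormalBasis ℝ V)]
  rw [integral_finsetSum _ fun p _ => integrable_sq_sum_inner _]
  simp only [integral_sq_sum_inner, norm_smul, OrthonormalBasis.norm_eq_one, mul_one,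
    Real.norm_eq_abs, sq_abs, Finset.sum_const, Finset.card_univ, Fintype.card_fin, nsmul_eq_mul]

end GaussianFamily

section Overlap

variable {ι J V : Type*} [Fintype ι] [Fintype J] [NormedAddCommGroup V] [InnerProductSpace ℝ V]

/-- The total squared overlap of a family of test vectors `G` with a family of vectors `y`. For
random `G` it measures how many directions the vectors `y` occupy. -/
noncomputable def overlap (G : J → V) (y : ι → V) : ℝ :=
  ∑ i, ∑ j, ⟪G j, y i⟫_ℝ ^ 2

/-- A quadratic form in `G` that bounds the overlap of `G` with `y` after a suitable rotation fixing
`W` has moved the components of `G` orthogonal to `W` into the span of the orthonormal family `x`: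
the first summand sees `y` only through its projection to `W`, the second only through its
projection to the span of `x`. -/
noncomputable def splitOverlap (W : Submodule ℝ V) [W.HasOrthogonalProjection] (x G : J → V)
    (y : ι → V) : ℝ :=
  ∑ i, (2 * ∑ j, ⟪G j, W.starProjection (y i)⟫_ℝ ^ 2 + 2 * ‖∑ j, ⟪x j, y i⟫_ℝ • G j‖ ^ 2)

theorem overlap_map_left (U : V ≃ₗᵢ[ℝ] V) (G : J → V) (y : ι → V) :
    overlap (fun j => U (G j)) y = overlap G fun i => U.symm (y i) := by
  simp only [overlap, U.inner_map_eq_flip]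

variable [FiniteDimensional ℝ V]

theorem norm_starProjection_le_of_le {W E : Submodule ℝ V} (hWE : W ≤ E) (y : V) :
    ‖W.starProjection y‖ ≤ ‖E.starProjection y‖ := by
  rw [← Submodule.starProjection_comp_starProjection_of_le hWE, ContinuousLinearMap.comp_apply]
  exact Submodule.norm_starProjection_apply_le _ _

theorem sum_sq_inner_le_norm_sq_starProjection {x : J → V} (hx : Orthonormal ℝ x)
    {E : Submodule ℝ V} (hxE : ∀ j, x j ∈ E) (y : V) :
    ∑ j, ⟪x j, y⟫_ℝ ^ 2 ≤ ‖E.starProjection y‖ ^ 2 := by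
  refine le_trans (le_of_eq (Finset.sum_congr rfl fun j _ => ?_))
    (hx.sum_inner_products_le (E.starProjection y) (s := Finset.univ))
  rw [← Submodule.inner_starProjection_left_eq_right,
    Submodule.starProjection_eq_self_iff.2 (hxE j), Real.norm_eq_abs, sq_abs]

variable [MeasurableSpace V] [BorelSpace V]

theorem measurable_overlap {Ω : Type*} [MeasurableSpace Ω] {G : Ω → J → V} {y : Ω → ι → V}
    (hG : Measurable G) (hy : Measurable y) : Measurable fun ω => overlap (G ω) (y ω) := by
  unfold overlap
  fun_prop

theorem measurable_splitOverlap (W : Submodule ℝ V) (x : J → V) {Ω : Type*} [MeasurableSpace Ω]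
    {G : Ω → J → V} {y : Ω → ι → V} (hG : Measurable G) (hy : Measurable y) :
    Measurable fun ω => splitOverlap W x (G ω) (y ω) := by
  unfold splitOverlap
  fun_prop

theorem RobustlyIndependent.lintegral_gaussianFamily_exp_neg_overlap_le [LinearOrder ι] {γ μ : ℝ}
    {y : ι → V} (hy : RobustlyIndependent γ y) (hγ : 0 < γ) (hμ : 0 < μ) :
    ∫⁻ G, ENNReal.ofReal (Real.exp (-(μ * overlap G y))) ∂gaussianFamily J V ≤
      ENNReal.ofReal (√(2 * μ * γ ^ 2))⁻¹ ^ (Fintype.card ι * Fintype.card J) := by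
  let F : V → ℝ≥0∞ := fun g => ENNReal.ofReal (Real.exp (-(μ * ∑ i, ⟪g, y i⟫_ℝ ^ 2)))
  have hF : Measurable F := by fun_prop
  have hindep : iIndepFun (fun (j : J) (G : J → V) => F (G j)) (gaussianFamily J V) :=
    iIndepFun_pi fun _ => hF.aemeasurable
  have heval : ∀ j, ∫⁻ G, F (G j) ∂gaussianFamily J V = ∫⁻ g, F g ∂stdGaussian V := fun j =>
    (measurePreserving_eval (fun _ : J => stdGaussian V) j).lintegral_comp hF
  calc ∫⁻ G, ENNReal.ofReal (Real.exp (-(μ * overlap G y))) ∂gaussianFamily J V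
      = ∫⁻ G : J → V, ∏ j, F (G j) ∂gaussianFamily J V := lintegral_congr fun G => by
        rw [← ENNReal.ofReal_prod_of_nonneg fun i _ => (Real.exp_pos _).le, ← Real.exp_sum,
          overlap, Finset.sum_comm, Finset.mul_sum, Finset.sum_neg_distrib]
    _ = ∏ j, ∫⁻ G, F (G j) ∂gaussianFamily J V :=
        lintegral_prod_eq_prod_lintegral_of_indepFun Finset.univ _ hindep
          fun j => hF.comp (measurable_pi_apply j)
    _ = (∫⁻ g, F g ∂stdGaussian V) ^ Fintype.card J := by
        simp only [heval, Finset.prod_const, Finset.card_univ]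
    _ ≤ ENNReal.ofReal (√(2 * μ * γ ^ 2))⁻¹ ^ (Fintype.card ι * Fintype.card J) := by
        rw [pow_mul]
        gcongr
        exact hy.lintegral_stdGaussian_exp_neg_le hγ hμ Finset.univ

theorem integrable_splitOverlap (W : Submodule ℝ V) (x : J → V) (y : ι → V) :
    Integrable (fun G => splitOverlap W x G y) (gaussianFamily J V) :=
  integrable_finsetSum _ fun _ _ =>
    ((integrable_finsetSum _ fun j _ => integrable_sq_inner j _).const_mul 2).add
      ((integrable_norm_sq_sum_smul _).const_mul 2)

theorem integral_splitOverlap (W : Submodule ℝ V) (x : J → V) (y : ι → V) :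
    ∫ G, splitOverlap W x G y ∂gaussianFamily J V =
      ∑ i, (2 * (Fintype.card J * ‖W.starProjection (y i)‖ ^ 2) +
        2 * (Module.finrank ℝ V * ∑ j, ⟪x j, y i⟫_ℝ ^ 2)) := by
  have hW : ∀ i, Integrable (fun G : J → V => 2 * ∑ j, ⟪G j, W.starProjection (y i)⟫_ℝ ^ 2)
      (gaussianFamily J V) := fun i =>
    (integrable_finsetSum _ fun j _ => integrable_sq_inner j _).const_mul 2
  have hx : ∀ i, Integrable (fun G : J → V => 2 * ‖∑ j, ⟪x j, y i⟫_ℝ • G j‖ ^ 2)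
      (gaussianFamily J V) := fun i => (integrable_norm_sq_sum_smul _).const_mul 2
  simp only [splitOverlap]
  rw [integral_finsetSum _ fun i _ => (hW i).fun_add (hx i)]
  refine Finset.sum_congr rfl fun i _ => ?_
  rw [integral_add (hW i) (hx i), integral_const_mul, integral_const_mul,
    integral_norm_sq_sum_smul, integral_finsetSum _ fun j _ => integrable_sq_inner j _]
  simp only [integral_sq_inner, Finset.sum_const, Finset.card_univ, nsmul_eq_mul]

theorem integral_splitOverlap_le {W E : Submodule ℝ V} (hWE : W ≤ E) {x : J → V}
    (hx : Orthonormal ℝ x) (hxE : ∀ j, x j ∈ E) {β : ℝ} {y : ι → V}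
    (hy : ∀ i, ‖E.starProjection (y i)‖ ≤ β) :
    ∫ G, splitOverlap W x G y ∂gaussianFamily J V ≤
      Fintype.card ι * (4 * Module.finrank ℝ V * β ^ 2) := by
  have hJ : (Fintype.card J : ℝ) ≤ Module.finrank ℝ V :=
    Nat.cast_le.2 hx.linearIndependent.fintype_card_le_finrank
  have hEy : ∀ i, ‖E.starProjection (y i)‖ ^ 2 ≤ β ^ 2 := fun i =>
    pow_le_pow_left₀ (norm_nonneg _) (hy i) 2
  rw [integral_splitOverlap, ← nsmul_eq_mul]
  refine Finset.sum_le_card_nsmul _ _ _ fun i _ => ?_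
  have hW : Fintype.card J * ‖W.starProjection (y i)‖ ^ 2 ≤ Module.finrank ℝ V * β ^ 2 := by
    gcongr
    exact (norm_starProjection_le_of_le hWE _).trans (hy i)
  have hxy : Module.finrank ℝ V * ∑ j, ⟪x j, y i⟫_ℝ ^ 2 ≤ Module.finrank ℝ V * β ^ 2 := by
    gcongr
    exact (sum_sq_inner_le_norm_sq_starProjection hx hxE _).trans (hEy i)
  linarith

theorem ofReal_exp_le_lintegral_exp_neg_splitOverlap {W E : Submodule ℝ V} (hWE : W ≤ E) {x : J → V}
    (hx : Orthonormal ℝ x) (hxE : ∀ j, x j ∈ E) {β μ : ℝ} (hμ : 0 ≤ μ) {y : ι → V}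
    (hy : ∀ i, ‖E.starProjection (y i)‖ ≤ β) :
    ENNReal.ofReal (Real.exp (-(μ * (Fintype.card ι * (4 * Module.finrank ℝ V * β ^ 2))))) ≤
      ∫⁻ G, ENNReal.ofReal (Real.exp (-(μ * splitOverlap W x G y))) ∂gaussianFamily J V := by
  refine le_trans ?_ (ofReal_exp_neg_integral_le_lintegral
    ((integrable_splitOverlap W x y).const_mul μ))
  rw [integral_const_mul]
  gcongr
  exact integral_splitOverlap_le hWE hx hxE hy

end Overlap

section Rotation

variable {ι J V : Type*} [NormedAddCommGroup V] [InnerProductSpace ℝ V]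
  [FiniteDimensional ℝ V]

theorem exists_linearIsometryEquiv_apply_eq {X : Type*} [AddCommGroup X] [Module ℝ X]
    {A B : X →ₗ[ℝ] V} (hAB : ∀ x, ‖A x‖ = ‖B x‖) :
    ∃ U : V ≃ₗᵢ[ℝ] V, ∀ x, U (A x) = B x := by
  obtain ⟨g, hg⟩ := A.rangeRestrict.exists_rightInverse_of_surjective A.range_rangeRestrict
  have hAg : ∀ v, A (g v) = v := fun v => congrArg Subtype.val (LinearMap.congr_fun hg v)
  let L : LinearMap.range A →ₗᵢ[ℝ] V :=
    { toLinearMap := B ∘ₗ g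
      norm_map' := fun v => by rw [LinearMap.comp_apply, ← hAB, hAg, Submodule.coe_norm] }
  refine ⟨L.extend.toLinearIsometryEquiv rfl, fun x => ?_⟩
  have hL : L.extend (A x) = B (g ⟨A x, x, rfl⟩) := L.extend_apply ⟨A x, x, rfl⟩
  rw [LinearIsometry.coe_toLinearIsometryEquiv, hL, ← sub_eq_zero, ← map_sub, ← norm_eq_zero,
    ← hAB, map_sub, hAg, sub_self, norm_zero]

/-- The operator is `√(T† T)`. -/
theorem exists_isSymmetric_norm_apply_eq (T : V →ₗ[ℝ] V) :
    ∃ S : V →ₗ[ℝ] V, S.IsSymmetric ∧ ∀ y, ‖S y‖ = ‖T y‖ := by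
  have hpos : (T.adjoint ∘ₗ T).IsPositive := T.isPositive_adjoint_comp_self
  let b := hpos.isSymmetric.eigenvectorBasis rfl
  let a := hpos.isSymmetric.eigenvalues rfl
  let S : V →ₗ[ℝ] V := b.toBasis.constr ℝ fun i => √(a i) • b i
  have hS : ∀ i y, ⟪b i, S y⟫_ℝ = √(a i) * ⟪b i, y⟫_ℝ := fun i y => by
    rw [← b.repr_apply_apply, Module.Basis.constr_apply_fintype]
    simp [Finset.sum_apply, b.repr_apply_apply, Pi.single_apply, mul_comm]
  refine ⟨S, fun x y => ?_, fun y => ?_⟩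
  · rw [← b.sum_inner_mul_inner, ← b.sum_inner_mul_inner x]
    refine Finset.sum_congr rfl fun i _ => ?_
    rw [real_inner_comm, hS, hS, real_inner_comm x]
    ring
  · rw [← sq_eq_sq₀ (norm_nonneg _) (norm_nonneg _), ← b.sum_sq_inner_right,
      ← real_inner_self_eq_norm_sq, ← T.adjoint_inner_right, ← b.sum_inner_mul_inner]
    refine Finset.sum_congr rfl fun i _ => ?_
    have heigen : ⟪b i, T.adjoint (T y)⟫_ℝ = a i * ⟪b i, y⟫_ℝ := by
      rw [← LinearMap.comp_apply, ← hpos.isSymmetric, hpos.isSymmetric.apply_eigenvectorBasis,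
        inner_smul_left]
      rfl
    rw [hS, heigen, mul_pow, Real.sq_sqrt (hpos.nonneg_eigenvalues rfl i), real_inner_comm]
    ring

theorem exists_isometry_fixing_comp_isSymmetric (W : Submodule ℝ V) {T : V →ₗ[ℝ] V}
    (hTW : ∀ w ∈ W, T w = 0) (hT : ∀ y, T y ∈ Wᗮ) :
    ∃ U : V ≃ₗᵢ[ℝ] V, (∀ w ∈ W, U w = w) ∧ (U.toLinearEquiv.toLinearMap ∘ₗ T).IsSymmetric := by
  obtain ⟨S, hS, hST⟩ := exists_isSymmetric_norm_apply_eq T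
  have hSW : ∀ w ∈ W, S w = 0 := fun w hw => by
    rw [← norm_eq_zero, hST, hTW w hw, norm_zero]
  have hSperp : ∀ y, S y ∈ Wᗮ := fun y w hw => by
    rw [← hS, hSW w hw, inner_zero_left]
  have hnorm : ∀ R : V →ₗ[ℝ] V, (∀ y, R y ∈ Wᗮ) → ∀ y,
      ‖(W.starProjection.toLinearMap + R) y‖ ^ 2 = ‖W.starProjection y‖ ^ 2 + ‖R y‖ ^ 2 :=
    fun R hR y => by
      simpa only [← sq, LinearMap.add_apply, ContinuousLinearMap.coe_coe] using
        norm_add_sq_eq_norm_sq_add_norm_sq_of_inner_eq_zero _ _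
          (hR y _ (W.starProjection_apply_mem y))
  obtain ⟨U, hU⟩ := exists_linearIsometryEquiv_apply_eq
    (A := W.starProjection.toLinearMap + T) (B := W.starProjection.toLinearMap + S) fun y => by
      rw [← sq_eq_sq₀ (norm_nonneg _) (norm_nonneg _), hnorm T hT, hnorm S hSperp, hST]
  have hfix : ∀ w ∈ W, U w = w := fun w hw => by
    simpa [hTW w hw, hSW w hw, Submodule.starProjection_eq_self_iff.2 hw] using hU w
  refine ⟨U, hfix, ?_⟩
  have hUT : U.toLinearEquiv.toLinearMap ∘ₗ T = S := LinearMap.ext fun y => by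
    have hUy := hU y
    rw [LinearMap.add_apply, map_add, LinearMap.add_apply] at hUy
    exact add_left_cancel ((congrArg (· + _)
      (hfix _ (W.starProjection_apply_mem y)).symm).trans hUy)
  exact hUT ▸ hS

theorem exists_isometry_fixing_overlap_le [Fintype ι] [Fintype J] (W : Submodule ℝ V)
    {x : J → V} (hx : Orthonormal ℝ x) (hxW : ∀ j, x j ∈ Wᗮ) (G : J → V) :
    ∃ U : V ≃ₗᵢ[ℝ] V, (∀ w ∈ W, U w = w) ∧
      ∀ y : ι → V, overlap (fun j => U (G j)) y ≤ splitOverlap W x G y := by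
  let T : V →ₗ[ℝ] V := ∑ j, (innerₗ V (x j)).smulRight (Wᗮ.starProjection (G j))
  have hTapply : ∀ y, T y = Wᗮ.starProjection (∑ j, ⟪x j, y⟫_ℝ • G j) := fun y => by
    simp [T]
  have hTx : ∀ j, T (x j) = Wᗮ.starProjection (G j) := fun j => by
    classical
    rw [hTapply]
    congr 1
    simp [orthonormal_iff_ite.1 hx]
  obtain ⟨U, hUW, hU⟩ := exists_isometry_fixing_comp_isSymmetric W (T := T)
    (fun w hw => by simp [T, fun j => Submodule.inner_left_of_mem_orthogonal hw (hxW j)])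
    fun y => hTapply y ▸ Submodule.starProjection_apply_mem _ _
  refine ⟨U, hUW, fun y => Finset.sum_le_sum fun i _ => ?_⟩
  have hsplit : ∀ j, ⟪U (G j), y i⟫_ℝ = ⟪G j, W.starProjection (y i)⟫_ℝ + ⟪x j, U (T (y i))⟫_ℝ :=
    fun j => by
      conv_lhs => rw [← W.starProjection_add_starProjection_orthogonal (G j), map_add,
        hUW _ (W.starProjection_apply_mem _), inner_add_left,
        Submodule.inner_starProjection_left_eq_right, ← hTx]
      exact congrArg _ (hU (x j) (y i))
  have hbessel : ∑ j, ⟪x j, U (T (y i))⟫_ℝ ^ 2 ≤ ‖∑ j, ⟪x j, y i⟫_ℝ • G j‖ ^ 2 :=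
    calc ∑ j, ⟪x j, U (T (y i))⟫_ℝ ^ 2 ≤ ‖U (T (y i))‖ ^ 2 := by
          simpa using hx.sum_inner_products_le (U (T (y i))) (s := Finset.univ)
      _ ≤ ‖∑ j, ⟪x j, y i⟫_ℝ • G j‖ ^ 2 := by
          rw [U.norm_map, hTapply]
          gcongr
          exact Submodule.norm_starProjection_apply_le _ _
  calc ∑ j, ⟪U (G j), y i⟫_ℝ ^ 2
      ≤ ∑ j, 2 * (⟪G j, W.starProjection (y i)⟫_ℝ ^ 2 + ⟪x j, U (T (y i))⟫_ℝ ^ 2) :=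
        Finset.sum_le_sum fun j _ => hsplit j ▸ add_sq_le
    _ = 2 * ∑ j, ⟪G j, W.starProjection (y i)⟫_ℝ ^ 2 + 2 * ∑ j, ⟪x j, U (T (y i))⟫_ℝ ^ 2 := by
        rw [← Finset.mul_sum, Finset.sum_add_distrib, mul_add]
    _ ≤ _ := by gcongr

end Rotation

section UniformSphere

open scoped Pointwise in
theorem map_toSphere_volume {E F : Type*} [NormedAddCommGroup E] [InnerProductSpace ℝ E]
    [FiniteDimensional ℝ E] [MeasurableSpace E] [BorelSpace E] [NormedAddCommGroup F]
    [InnerProductSpace ℝ F] [FiniteDimensional ℝ F] [MeasurableSpace F] [BorelSpace F]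
    (e : E ≃ₗᵢ[ℝ] F) {φ : Metric.sphere (0 : E) 1 → Metric.sphere (0 : F) 1}
    (hφ : ∀ x, (φ x : F) = e x) :
    (volume : Measure E).toSphere.map φ = (volume : Measure F).toSphere := by
  have hφ_meas : Measurable φ :=
    Measurable.subtype_mk (f := fun x => (φ x : F)) (by simp only [hφ]; fun_prop)
  have hφ_surj : Function.Surjective φ := fun y =>
    ⟨⟨e.symm y, by simp⟩, Subtype.ext (by simp [hφ])⟩
  ext s hs
  rw [Measure.map_apply hφ_meas hs, Measure.toSphere_apply' _ (hφ_meas hs),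
    Measure.toSphere_apply' _ hs, e.toLinearEquiv.finrank_eq]
  have himage : Subtype.val '' s = e '' (Subtype.val '' (φ ⁻¹' s)) := by
    conv_lhs => rw [← Set.image_preimage_eq s hφ_surj]
    simp only [Set.image_image, hφ]
  have hcone : Set.Ioo (0 : ℝ) 1 • (Subtype.val '' s) =
      e.symm ⁻¹' (Set.Ioo (0 : ℝ) 1 • (Subtype.val '' (φ ⁻¹' s))) := by
    rw [himage, ← e.image_eq_preimage_symm]
    exact (Set.image_image2_distrib_right fun t v => map_smul e t v).symm
  rw [hcone]
  congr 1
  exact (e.symm.measurePreserving.measure_preimage_equiv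
    (f := e.symm.toHomeomorph.toMeasurableEquiv) _).symm

variable {d : ℕ}

theorem uniformSphere_map (E : Submodule ℝ (Vec d)) (U : Vec d ≃ₗᵢ[ℝ] Vec d) :
    uniformSphere (E.map U.toLinearEquiv.toLinearMap) = (uniformSphere E).map U := by
  let e : E ≃ₗᵢ[ℝ] E.map U.toLinearEquiv.toLinearMap :=
    { U.toLinearEquiv.submoduleMap E with norm_map' := fun x => U.norm_map x }
  let φ : Metric.sphere (0 : E) 1 → Metric.sphere (0 : E.map U.toLinearEquiv.toLinearMap) 1 :=
    fun x => ⟨e x, by simp⟩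
  have hφ : Measurable φ := Measurable.subtype_mk (by fun_prop)
  simp only [uniformSphere]
  rw [← map_toSphere_volume e (φ := φ) fun _ => rfl, Measure.map_apply hφ .univ, Set.preimage_univ,
    Measure.map_smul, Measure.map_smul, Measure.map_smul, Measure.map_map (by fun_prop) hφ,
    Measure.map_map (by fun_prop) (by fun_prop)]
  rfl

theorem pi_uniformSphere_map_apply {ι : Type*} [Fintype ι] {E : Submodule ℝ (Vec d)} (hE : E ≠ ⊥)
    (U : Vec d ≃ₗᵢ[ℝ] Vec d) (A : Set (ι → Vec d)) :
    (Measure.pi fun _ : ι => uniformSphere (E.map U.toLinearEquiv.toLinearMap)) A =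
      (Measure.pi fun _ : ι => uniformSphere E) {w | (fun l => U (w l)) ∈ A} := by
  have := isProbabilityMeasure_uniformSphere hE
  have : IsProbabilityMeasure ((uniformSphere E).map U) :=
    Measure.isProbabilityMeasure_map (by fun_prop)
  simp only [uniformSphere_map]
  rw [← Measure.pi_map_pi (f := fun _ => U) fun _ => by fun_prop]
  exact (MeasurableEquiv.piCongrRight fun _ => U.toHomeomorph.toMeasurableEquiv).map_apply A

theorem ae_mem_of_pi_uniformSphere {ι : Type*} [Fintype ι] {E : Submodule ℝ (Vec d)}
    (hE : E ≠ ⊥) : ∀ᵐ w ∂(Measure.pi fun _ : ι => uniformSphere E), ∀ l, w l ∈ E := by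
  have := isProbabilityMeasure_uniformSphere hE
  have hmem : ∀ᵐ x ∂uniformSphere E, x ∈ E :=
    (ae_map_iff (p := fun x => x ∈ E) (Measurable.aemeasurable (by fun_prop))
      (Submodule.closed_of_finiteDimensional E).measurableSet).2 (.of_forall fun x => x.1.2)
  exact ae_all_iff.2 fun l =>
    (Measure.quasiMeasurePreserving_eval (fun _ : ι => uniformSphere E) l).ae hmem

theorem Gr.ne_bot {n : ℕ} (hn : 0 < n) (E : Gr d n) : E.1 ≠ ⊥ := fun h =>
  hn.ne (by rw [← E.2, h, finrank_bot])

instance : (haarOrth d).IsMulRightInvariant := by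
  have : (haarOrth d).IsHaarMeasure := by unfold haarOrth; infer_instance
  refine ⟨fun g => ?_⟩
  have : IsProbabilityMeasure ((haarOrth d).map (· * g)) :=
    Measure.isProbabilityMeasure_map (by fun_prop)
  exact Measure.isHaarMeasure_eq_of_isProbabilityMeasure _ _

end UniformSphere

section Wins

variable {ι V : Type*} {β γ : ℝ}

theorem le_norm_starProjection_orthogonal_iff [NormedAddCommGroup V] [InnerProductSpace ℝ V]
    {S : Submodule ℝ V} [S.HasOrthogonalProjection] {v : V} :
    γ ≤ ‖Sᗮ.starProjection v‖ ↔ ∀ x ∈ S, γ ≤ ‖v - x‖ := by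
  refine ⟨fun h x hx => h.trans ?_, fun h => ?_⟩
  · have hsub : Sᗮ.starProjection (v - x) = Sᗮ.starProjection v := by
      rw [map_sub, Submodule.starProjection_orthogonal_apply_eq_zero hx, sub_zero]
    exact hsub ▸ Submodule.norm_starProjection_apply_le _ _
  · rw [Submodule.starProjection_orthogonal_val]
    exact h _ (S.starProjection_apply_mem v)

theorem robustlyIndependent_map_iff [Preorder ι] [NormedAddCommGroup V] [NormedSpace ℝ V]
    (U : V ≃ₗᵢ[ℝ] V) {y : ι → V} :
    RobustlyIndependent γ (fun i => U (y i)) ↔ RobustlyIndependent γ y := by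
  have hspan : ∀ i, Submodule.span ℝ ((fun i => U (y i)) '' Set.Iio i) =
      (Submodule.span ℝ (y '' Set.Iio i)).map U.toLinearEquiv.toLinearMap := fun i => by
    rw [Submodule.map_span, Set.image_image]
    rfl
  simp only [RobustlyIndependent, hspan, Submodule.mem_map, forall_exists_index, and_imp,
    forall_apply_eq_imp_iff₂, LinearEquiv.coe_coe, LinearIsometryEquiv.coe_toLinearEquiv,
    ← map_sub, LinearIsometryEquiv.norm_map]

theorem isClosed_setOf_robustlyIndependent [Preorder ι] [NormedAddCommGroup V] [NormedSpace ℝ V] :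
    IsClosed {y : ι → V | RobustlyIndependent γ y} := by
  simp only [RobustlyIndependent, Finsupp.mem_span_image_iff_linearCombination,
    forall_exists_index, and_imp, forall_apply_eq_imp_iff₂, Finsupp.linearCombination_apply,
    Finsupp.sum, Set.ofPred_forall]
  exact isClosed_iInter fun i => isClosed_iInter fun l => isClosed_iInter fun _ =>
    isClosed_le continuous_const (by fun_prop)

variable {d k : ℕ} {E : Submodule ℝ (Vec d)}

theorem wins_iff {y : Fin k → Vec d} :
    Wins β γ E y ↔ (∀ i, ‖E.starProjection (y i)‖ ≤ β) ∧ RobustlyIndependent γ y := by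
  simp only [Wins, forall_and, le_norm_starProjection_orthogonal_iff]
  rfl

theorem isClosed_setOf_wins : IsClosed {y : Fin k → Vec d | Wins β γ E y} := by
  simp only [wins_iff, Set.ofPred_and, Set.ofPred_forall]
  exact (isClosed_iInter fun i => isClosed_le (by fun_prop) continuous_const).inter
    isClosed_setOf_robustlyIndependent

theorem wins_map_iff (U : Vec d ≃ₗᵢ[ℝ] Vec d) {y : Fin k → Vec d} :
    Wins β γ (E.map U.toLinearEquiv.toLinearMap) (fun i => U (y i)) ↔ Wins β γ E y := by
  have hproj : ∀ v, ‖(E.map U.toLinearEquiv.toLinearMap).starProjection (U v)‖ =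
      ‖E.starProjection v‖ := fun v => by
    have h := Submodule.starProjection_map_apply U E (U v)
    rw [U.symm_apply_apply] at h
    exact (congrArg norm h).trans (U.norm_map _)
  simp only [wins_iff, hproj, robustlyIndependent_map_iff]

end Wins

section PulledBack

variable {d m k : ℕ} {ι : Type*} {β γ μ : ℝ}

/-- The answer of the output function `y` to the samples `w` rotated by `U`, rotated back. For Haar
distributed `U` this reduces the game on a random subspace to a game on a fixed one. -/
noncomputable def pulledBack (y : (Fin m → Vec d) → Fin k → Vec d) (U : Orth d)
    (w : Fin m → Vec d) : Fin k → Vec d := fun i =>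
  (Unitary.linearIsometryEquiv U).symm (y (fun l => Unitary.linearIsometryEquiv U (w l)) i)

theorem measurable_pulledBack {y : (Fin m → Vec d) → Fin k → Vec d} (hy : Measurable y) :
    Measurable fun p : Orth d × (Fin m → Vec d) => pulledBack y p.1 p.2 := by
  have hrotate : Measurable fun p : Orth d × (Fin m → Vec d) => fun l =>
      (p.1 : Vec d →L[ℝ] Vec d) (p.2 l) := Continuous.measurable (by fun_prop)
  have hstar : Measurable fun p : Orth d × (Fin m → Vec d) =>
      star (p.1 : Vec d →L[ℝ] Vec d) := Continuous.measurable (by fun_prop)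
  have happly : Measurable fun q : (Vec d →L[ℝ] Vec d) × Vec d => q.1 q.2 :=
    Continuous.measurable (by fun_prop)
  exact measurable_pi_lambda _ fun i =>
    happly.comp (hstar.prodMk ((measurable_pi_apply i).comp (hy.comp hrotate)))

theorem wins_rotate_iff {n : ℕ} {E : Gr d n} {U : Orth d} {y : (Fin m → Vec d) → Fin k → Vec d}
    {w : Fin m → Vec d} :
    Wins β γ (rotate U E).1 (y fun l => Unitary.linearIsometryEquiv U (w l)) ↔
      Wins β γ E.1 (pulledBack y U w) := by
  rw [← wins_map_iff (Unitary.linearIsometryEquiv U) (y := pulledBack y U w)]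
  simp only [pulledBack, LinearIsometryEquiv.apply_symm_apply]
  rfl

/-- A family of vectors depending on an orthogonal map `U` transforms by the inverse of `H` when `U`
is composed with an `H` that fixes `W` pointwise. -/
def FixatorEquivariant (W : Submodule ℝ (Vec d)) (z : Orth d → ι → Vec d) : Prop :=
  ∀ U H : Orth d, (∀ w ∈ W, Unitary.linearIsometryEquiv H w = w) →
    z (U * H) = fun i => (Unitary.linearIsometryEquiv H).symm (z U i)

theorem fixatorEquivariant_pulledBack (y : (Fin m → Vec d) → Fin k → Vec d) (w : Fin m → Vec d) :
    FixatorEquivariant (Submodule.span ℝ (Set.range w)) fun U => pulledBack y U w := by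
  intro U H hH
  have hmul : ∀ v, Unitary.linearIsometryEquiv (U * H) v =
      Unitary.linearIsometryEquiv U (Unitary.linearIsometryEquiv H v) := fun _ => rfl
  have hw : ∀ l, Unitary.linearIsometryEquiv H (w l) = w l := fun l =>
    hH _ (Submodule.subset_span ⟨l, rfl⟩)
  funext i
  simp only [pulledBack, LinearIsometryEquiv.symm_apply_eq, hmul, hw,
    LinearIsometryEquiv.apply_symm_apply]

variable {J : Type*} [Fintype ι] [Fintype J] {W E : Submodule ℝ (Vec d)} {z : Orth d → ι → Vec d}

theorem FixatorEquivariant.setLIntegral_exp_neg_splitOverlap_le [Preorder ι]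
    (hz : FixatorEquivariant W z) (hz_meas : Measurable z) (hμ : 0 ≤ μ) {x : J → Vec d}
    (hx : Orthonormal ℝ x) (hxW : ∀ j, x j ∈ Wᗮ) (G : J → Vec d) :
    ∫⁻ U in {U | RobustlyIndependent γ (z U)},
        ENNReal.ofReal (Real.exp (-(μ * splitOverlap W x G (z U)))) ∂haarOrth d ≤
      ∫⁻ U in {U | RobustlyIndependent γ (z U)},
        ENNReal.ofReal (Real.exp (-(μ * overlap G (z U)))) ∂haarOrth d := by
  set R := {U | RobustlyIndependent γ (z U)}
  have hR : MeasurableSet R := hz_meas isClosed_setOf_robustlyIndependent.measurableSet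
  have hoverlap : Measurable fun U => overlap G (z U) := measurable_overlap measurable_const hz_meas
  obtain ⟨h, hW, hle⟩ := exists_isometry_fixing_overlap_le (ι := ι) W hx hxW G
  set H : Orth d := Unitary.linearIsometryEquiv.symm h
  have hH : Unitary.linearIsometryEquiv H = h := Unitary.linearIsometryEquiv.apply_symm_apply h
  have hzH : ∀ U, z (U * H) = fun i => h.symm (z U i) := fun U => by
    rw [hz U H (by rwa [hH]), hH]
  have hRH : (· * H) ⁻¹' R = R := Set.ext fun U => by
    simp only [R, Set.mem_preimage, Set.mem_ofPred_eq, hzH, robustlyIndependent_map_iff]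
  have hshift := (measurePreserving_mul_right (haarOrth d) H).setLIntegral_comp_preimage hR
    (f := fun U => ENNReal.ofReal (Real.exp (-(μ * overlap G (z U))))) (by fun_prop)
  rw [← hshift, hRH]
  simp only [hzH, ← overlap_map_left]
  gcongr with U
  exact hle (z U)

theorem FixatorEquivariant.setLIntegral_lintegral_exp_neg_splitOverlap_le [Preorder ι]
    (hz : FixatorEquivariant W z) (hz_meas : Measurable z) (hμ : 0 ≤ μ) {x : J → Vec d}
    (hx : Orthonormal ℝ x) (hxW : ∀ j, x j ∈ Wᗮ) :
    ∫⁻ U in {U | RobustlyIndependent γ (z U)}, ∫⁻ G,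
        ENNReal.ofReal (Real.exp (-(μ * splitOverlap W x G (z U)))) ∂gaussianFamily J (Vec d)
        ∂haarOrth d ≤
      ∫⁻ U in {U | RobustlyIndependent γ (z U)}, ∫⁻ G,
        ENNReal.ofReal (Real.exp (-(μ * overlap G (z U)))) ∂gaussianFamily J (Vec d)
        ∂haarOrth d := by
  have hz' : Measurable fun p : Orth d × (J → Vec d) => z p.1 := hz_meas.comp measurable_fst
  have hsplit : Measurable fun p : Orth d × (J → Vec d) =>
      ENNReal.ofReal (Real.exp (-(μ * splitOverlap W x p.2 (z p.1)))) := by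
    have := measurable_splitOverlap W x measurable_snd hz'
    fun_prop
  have hoverlap : Measurable fun p : Orth d × (J → Vec d) =>
      ENNReal.ofReal (Real.exp (-(μ * overlap p.2 (z p.1)))) := by
    have := measurable_overlap measurable_snd hz'
    fun_prop
  refine (lintegral_lintegral_swap hsplit.aemeasurable).trans_le ?_
  refine le_trans ?_ (lintegral_lintegral_swap hoverlap.aemeasurable).ge
  exact lintegral_mono (hz.setLIntegral_exp_neg_splitOverlap_le hz_meas hμ hx hxW)

theorem FixatorEquivariant.haarOrth_setOf_wins_le {z : Orth d → Fin k → Vec d}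
    (hz : FixatorEquivariant W z) (hz_meas : Measurable z) (hγ : 0 < γ) (hμ : 0 < μ) (hWE : W ≤ E)
    {x : J → Vec d} (hx : Orthonormal ℝ x) (hxWE : ∀ j, x j ∈ Wᗮ ⊓ E) :
    haarOrth d {U | Wins β γ E (z U)} ≤ ENNReal.ofReal (Real.exp (μ * (k * (4 * d * β ^ 2)))) *
      ENNReal.ofReal (√(2 * μ * γ ^ 2))⁻¹ ^ (k * Fintype.card J) := by
  set A := {U | Wins β γ E (z U)}
  set R := {U | RobustlyIndependent γ (z U)}
  set c := μ * (k * (4 * d * β ^ 2))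
  have hA : MeasurableSet A := hz_meas isClosed_setOf_wins.measurableSet
  have hR : MeasurableSet R := hz_meas isClosed_setOf_robustlyIndependent.measurableSet
  have hAR : A ⊆ R := fun U hU => (wins_iff.1 hU).2
  have hlower : ∀ U ∈ A, ENNReal.ofReal (Real.exp (-c)) ≤
      ∫⁻ G, ENNReal.ofReal (Real.exp (-(μ * splitOverlap W x G (z U))))
        ∂gaussianFamily J (Vec d) := fun U hU => by
    have hjensen := ofReal_exp_le_lintegral_exp_neg_splitOverlap hWE hx (fun j => (hxWE j).2) hμ.le
      (wins_iff.1 hU).1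
    rwa [finrank_euclideanSpace_fin, Fintype.card_fin] at hjensen
  have hbound : ENNReal.ofReal (Real.exp (-c)) * haarOrth d A ≤
      ENNReal.ofReal (√(2 * μ * γ ^ 2))⁻¹ ^ (k * Fintype.card J) :=
    calc ENNReal.ofReal (Real.exp (-c)) * haarOrth d A
        = ∫⁻ _ in A, ENNReal.ofReal (Real.exp (-c)) ∂haarOrth d := (setLIntegral_const _ _).symm
      _ ≤ ∫⁻ U in A, ∫⁻ G, ENNReal.ofReal (Real.exp (-(μ * splitOverlap W x G (z U))))
            ∂gaussianFamily J (Vec d) ∂haarOrth d := setLIntegral_mono' hA hlower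
      -- Invariance under the fixator of `W` holds for `R`, but not for `A`.
      _ ≤ ∫⁻ U in R, ∫⁻ G, ENNReal.ofReal (Real.exp (-(μ * splitOverlap W x G (z U))))
            ∂gaussianFamily J (Vec d) ∂haarOrth d := lintegral_mono_set hAR
      _ ≤ ∫⁻ U in R, ∫⁻ G, ENNReal.ofReal (Real.exp (-(μ * overlap G (z U))))
            ∂gaussianFamily J (Vec d) ∂haarOrth d :=
          hz.setLIntegral_lintegral_exp_neg_splitOverlap_le hz_meas hμ.le hx fun j => (hxWE j).1
      _ ≤ ∫⁻ _ in R, ENNReal.ofReal (√(2 * μ * γ ^ 2))⁻¹ ^ (k * Fintype.card J) ∂haarOrth d :=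
          setLIntegral_mono' hR fun U hU => by
            simpa using RobustlyIndependent.lintegral_gaussianFamily_exp_neg_overlap_le hU hγ hμ
      _ ≤ ENNReal.ofReal (√(2 * μ * γ ^ 2))⁻¹ ^ (k * Fintype.card J) := by
          rw [setLIntegral_const]
          exact mul_le_of_le_one_right' prob_le_one
  rwa [Real.exp_neg, ENNReal.ofReal_inv_of_pos (Real.exp_pos c),
    ENNReal.inv_mul_le_iff (by simp [Real.exp_pos]) ENNReal.ofReal_ne_top] at hbound

end PulledBack

section WinProb

variable {d m n k : ℕ} {β γ : ℝ}

/-- The choice `μ = n / (16 d β²)` makes the Jensen factor equal to `exp (k n / 4)`, while each of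
the other `k r ≥ k n / 2` factors is at most `exp (-1)`. -/
theorem exp_mul_inv_sqrt_pow_le {r : ℕ} (hd : 0 < d) (hn : 0 < n) (hβ : 0 < β)
    (hratio : 12 * √((d : ℝ) / n) ≤ γ / β) (hr : n ≤ 2 * r) :
    Real.exp (n / (16 * d * β ^ 2) * (k * (4 * d * β ^ 2))) *
        (√(2 * (n / (16 * d * β ^ 2)) * γ ^ 2))⁻¹ ^ (k * r) ≤
      Real.exp (-(k * n / 4)) := by
  have _ : (0 : ℝ) < d := Nat.cast_pos.2 hd
  have _ : (0 : ℝ) < n := Nat.cast_pos.2 hn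
  have hr' : (n : ℝ) ≤ 2 * r := by exact_mod_cast hr
  have hratio_sq : 144 * ((d : ℝ) / n) ≤ (γ / β) ^ 2 := by
    have := pow_le_pow_left₀ (by positivity) hratio 2
    rw [mul_pow, Real.sq_sqrt (by positivity)] at this
    linarith
  have hsqrt : Real.exp 1 ≤ √(2 * (n / (16 * d * β ^ 2)) * γ ^ 2) := by
    refine Real.le_sqrt_of_sq_le ?_
    calc Real.exp 1 ^ 2 ≤ 18 := by nlinarith [Real.exp_one_lt_d9, Real.exp_pos 1]
      _ = 144 * ((d : ℝ) / n) * (n / (8 * d)) := by field_simp; norm_num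
      _ ≤ (γ / β) ^ 2 * (n / (8 * d)) := by gcongr
      _ = 2 * (n / (16 * d * β ^ 2)) * γ ^ 2 := by field_simp; ring
  calc Real.exp (n / (16 * d * β ^ 2) * (k * (4 * d * β ^ 2))) *
        (√(2 * (n / (16 * d * β ^ 2)) * γ ^ 2))⁻¹ ^ (k * r)
      ≤ Real.exp (n / (16 * d * β ^ 2) * (k * (4 * d * β ^ 2))) * (Real.exp 1)⁻¹ ^ (k * r) := by
        gcongr
    _ = Real.exp (k * n / 4 - k * r) := by
        rw [← Real.exp_neg, ← Real.exp_nat_mul, ← Real.exp_add]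
        congr 1
        push_cast
        field_simp
        ring
    _ ≤ Real.exp (-(k * n / 4)) := by
        gcongr
        linarith [mul_le_mul_of_nonneg_left hr' k.cast_nonneg]

theorem haarOrth_setOf_wins_pulledBack_le (hn : 0 < n) (hβ : 0 < β) (hγ : 0 < γ)
    (hratio : 12 * √((d : ℝ) / n) ≤ γ / β) (hm : 2 * m ≤ n) (E : Gr d n) {w : Fin m → Vec d}
    (hw : ∀ l, w l ∈ E.1) {y : (Fin m → Vec d) → Fin k → Vec d} (hy : Measurable y) :
    haarOrth d {U | Wins β γ E.1 (pulledBack y U w)} ≤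
      ENNReal.ofReal (Real.exp (-(k * n / 4))) := by
  set W := Submodule.span ℝ (Set.range w)
  have hd : 0 < d :=
    hn.trans_le (E.2 ▸ (Submodule.finrank_le E.1).trans_eq finrank_euclideanSpace_fin)
  have hWE : W ≤ E.1 := Submodule.span_le.2 (Set.range_subset_iff.2 hw)
  have hr : n ≤ 2 * Module.finrank ℝ (Wᗮ ⊓ E.1 : Submodule ℝ (Vec d)) := by
    have hsum := Submodule.finrank_add_inf_finrank_orthogonal hWE
    have hWm : Module.finrank ℝ W ≤ m :=
      (finrank_range_le_card (R := ℝ) w).trans_eq (Fintype.card_fin m)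
    rw [E.2] at hsum
    omega
  let b := stdOrthonormalBasis ℝ (Wᗮ ⊓ E.1 : Submodule ℝ (Vec d))
  have hb : Orthonormal ℝ fun j => (b j : Vec d) :=
    b.orthonormal.comp_linearIsometry (Wᗮ ⊓ E.1).subtypeₗᵢ
  have hz_meas : Measurable fun U => pulledBack y U w :=
    (measurable_pulledBack hy).of_uncurry_right
  have hμ : 0 < (n : ℝ) / (16 * d * β ^ 2) := by positivity
  refine ((fixatorEquivariant_pulledBack y w).haarOrth_setOf_wins_le hz_meas hγ hμ hWE hb
    fun j => (b j).2).trans ?_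
  rw [Fintype.card_fin, ← ENNReal.ofReal_pow (by positivity),
    ← ENNReal.ofReal_mul (Real.exp_pos _).le]
  exact ENNReal.ofReal_le_ofReal (exp_mul_inv_sqrt_pow_le hd hn hβ hratio hr)

theorem lintegral_uniformSubspace_pi_le (hn0 : 0 < n) (hn : n ≤ d)
    {f : Gr d n → Set (Fin m → Vec d)} :
    ∫⁻ E, (Measure.pi fun _ : Fin m => uniformSphere E.1) (f E) ∂uniformSubspace hn ≤
      ∫⁻ U, (Measure.pi fun _ : Fin m => uniformSphere (baseSubspace hn).1)
        {w | (fun l => Unitary.linearIsometryEquiv U (w l)) ∈ f (rotate U (baseSubspace hn))}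
        ∂haarOrth d := by
  refine (lintegral_map_le _ _).trans_eq (lintegral_congr fun U => ?_)
  exact pi_uniformSphere_map_apply (Gr.ne_bot hn0 _) _ _

theorem prod_haarOrth_setOf_wins_pulledBack_le (hn : 0 < n) (hβ : 0 < β) (hγ : 0 < γ)
    (hratio : 12 * √((d : ℝ) / n) ≤ γ / β) (hm : 2 * m ≤ n) (E : Gr d n)
    {y : (Fin m → Vec d) → Fin k → Vec d} (hy : Measurable y) :
    ((haarOrth d).prod (Measure.pi fun _ : Fin m => uniformSphere E.1))
        {p | Wins β γ E.1 (pulledBack y p.1 p.2)} ≤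
      ENNReal.ofReal (Real.exp (-(k * n / 4))) := by
  have hE := Gr.ne_bot hn E
  have := isProbabilityMeasure_uniformSphere hE
  refine (Measure.prod_apply_symm
    (measurable_pulledBack hy isClosed_setOf_wins.measurableSet)).trans_le ?_
  refine (lintegral_mono_ae ((ae_mem_of_pi_uniformSphere hE).mono fun w hw =>
    haarOrth_setOf_wins_pulledBack_le hn hβ hγ hratio hm E hw hy)).trans_eq ?_
  rw [lintegral_const, measure_univ, mul_one]

theorem lintegral_pi_setOf_wins_le {κ : Type*} [Fintype κ] (hn0 : 0 < n) (hn : n ≤ d) (hβ : 0 < β)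
    (hγ : 0 < γ) (hratio : 12 * √((d : ℝ) / n) ≤ γ / β) (hm : 2 * m ≤ n)
    (message : Gr d n → (Fin m → Vec d) → κ) {output : κ → (Fin m → Vec d) → Fin k → Vec d}
    (houtput : ∀ a, Measurable (output a)) :
    ∫⁻ E, (Measure.pi fun _ : Fin m => uniformSphere E.1)
        {v | Wins β γ E.1 (output (message E v) v)} ∂uniformSubspace hn ≤
      Fintype.card κ * ENNReal.ofReal (Real.exp (-(k * n / 4))) := by
  set E := baseSubspace hn
  have := isProbabilityMeasure_uniformSphere (Gr.ne_bot hn0 E)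
  set ν := Measure.pi fun _ : Fin m => uniformSphere E.1
  let B : κ → Set (Orth d × (Fin m → Vec d)) := fun a =>
    {p | Wins β γ E.1 (pulledBack (output a) p.1 p.2)}
  have hB : ∀ a, MeasurableSet (B a) := fun a =>
    measurable_pulledBack (houtput a) isClosed_setOf_wins.measurableSet
  calc ∫⁻ F, (Measure.pi fun _ : Fin m => uniformSphere F.1)
        {v | Wins β γ F.1 (output (message F v) v)} ∂uniformSubspace hn
      ≤ ∫⁻ U, ν {w | (fun l => Unitary.linearIsometryEquiv U (w l)) ∈
          {v | Wins β γ (rotate U E).1 (output (message (rotate U E) v) v)}} ∂haarOrth d :=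
        lintegral_uniformSubspace_pi_le hn0 hn
    _ ≤ ∫⁻ U, ν (Prod.mk U ⁻¹' ⋃ a, B a) ∂haarOrth d := lintegral_mono fun U =>
        measure_mono fun w hw => Set.mem_iUnion.2 ⟨_, wins_rotate_iff.1 hw⟩
    _ = ((haarOrth d).prod ν) (⋃ a, B a) := (Measure.prod_apply (.iUnion hB)).symm
    _ ≤ ∑ a, ((haarOrth d).prod ν) (B a) := measure_iUnion_fintype_le _ _
    _ ≤ ∑ _a : κ, ENNReal.ofReal (Real.exp (-(k * n / 4))) := Finset.sum_le_sum fun a _ =>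
        prod_haarOrth_setOf_wins_pulledBack_le hn0 hβ hγ hratio hm E (houtput a)
    _ = Fintype.card κ * ENNReal.ofReal (Real.exp (-(k * n / 4))) := by
        rw [Finset.sum_const, nsmul_eq_mul, Finset.card_univ]

theorem winProb_le {Ω : Type*} [MeasurableSpace Ω] (P : Measure Ω) [IsProbabilityMeasure P]
    {M : ℕ} (hn0 : 0 < n) (hn : n ≤ d) (hβ : 0 < β) (hγ : 0 < γ)
    (hratio : 12 * √((d : ℝ) / n) ≤ γ / β) (hm : 2 * m ≤ n) (S : Strategy Ω d n m M k) :
    winProb P hn S β γ ≤ ENNReal.ofReal (Real.exp (M * Real.log 2 - k * n / 4)) := by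
  have houtput : ∀ ω a, Measurable (S.output ω a) := fun ω a =>
    S.measurable_output.comp (measurable_const.prodMk (measurable_const.prodMk measurable_id))
  refine (lintegral_mono fun ω => lintegral_pi_setOf_wins_le hn0 hn hβ hγ hratio hm (S.message ω)
    (houtput ω)).trans_eq ?_
  rw [lintegral_const, measure_univ, mul_one, sub_eq_add_neg, Real.exp_add, Real.exp_nat_mul,
    Real.exp_log two_pos, ENNReal.ofReal_mul (by positivity)]
  simp

theorem four_mul_log_lt_of_le {C : ℝ} {M : ℕ} (hd : 8 ≤ d) (hC : 1 ≤ C) (hγ0 : 0 < γ) (hγ1 : γ ≤ 1)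
    (hn : 0 < n) (hk : 50 * C * (((M : ℝ) + 2) / n) * Real.log (√d / γ) ≤ k) :
    4 * (M * Real.log 2 + Real.log C) < k * n := by
  have hd' : (8 : ℝ) ≤ d := by exact_mod_cast hd
  have hlog : 1 ≤ Real.log (√d / γ) := by
    rw [Real.le_log_iff_exp_le (by positivity)]
    calc Real.exp 1 ≤ √d :=
          Real.le_sqrt_of_sq_le (by nlinarith [Real.exp_one_lt_d9, Real.exp_pos 1])
      _ ≤ √d / γ := le_div_self (Real.sqrt_nonneg _) hγ0 hγ1
  have hlogC : Real.log C ≤ C - 1 := Real.log_le_sub_one_of_pos (by positivity)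
  have hMlog : M * Real.log 2 ≤ M := mul_le_of_le_one_right M.cast_nonneg (by
    linarith [Real.log_two_lt_d9])
  have hMC : (M : ℝ) ≤ C * M := le_mul_of_one_le_left M.cast_nonneg hC
  calc 4 * (M * Real.log 2 + Real.log C) < 50 * C * ((M : ℝ) + 2) := by linarith
    _ = 50 * C * (((M : ℝ) + 2) / n) * n := by field_simp
    _ ≤ 50 * C * (((M : ℝ) + 2) / n) * Real.log (√d / γ) * n :=
        mul_le_mul_of_nonneg_right (le_mul_of_one_le_right (by positivity) hlog) n.cast_nonneg
    _ ≤ k * n := by gcongr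

theorem sqrt_div_le_sqrt_mul_div {C : ℝ} {M : ℕ} (hC : 1 ≤ C)
    (hk : 4 * (M * Real.log 2 + Real.log C) < k * n) : √((d : ℝ) / n) ≤ √((k : ℝ) * d / n) := by
  have hlog : 0 ≤ Real.log C := Real.log_nonneg hC
  have hkn : (0 : ℝ) < k * n := lt_of_le_of_lt (by positivity) hk
  have hk1 : (1 : ℝ) ≤ k :=
    Nat.one_le_cast.2 (Nat.cast_pos.1 (pos_of_mul_pos_left hkn n.cast_nonneg))
  gcongr
  exact le_mul_of_one_le_left d.cast_nonneg hk1

end WinProb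

end OrthogonalSubspaceGame

theorem mainTheorem6_general {Ω : Type*} [MeasurableSpace Ω] (P : Measure Ω)
    [IsProbabilityMeasure P] {d n m M k : ℕ} (hn : n ≤ d) {C β γ : ℝ} (hC : 0 < C) (hβ : 0 < β)
    (hγ : 0 < γ) (hratio : 12 * √((d : ℝ) / n) ≤ γ / β)
    (hk : 4 * (M * Real.log 2 + Real.log C) < k * n)
    (S : OrthogonalSubspaceGame.Strategy Ω d n m M k)
    (hwin : ENNReal.ofReal (1 / C) ≤ OrthogonalSubspaceGame.winProb P hn S β γ) :
    (n : ℝ) / 2 ≤ m := by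
  by_contra! hm
  have hm' : 2 * m < n := by
    rw [lt_div_iff₀ two_pos, mul_comm] at hm
    exact_mod_cast hm
  have hle : 1 / C ≤ Real.exp (M * Real.log 2 - k * n / 4) :=
    (ENNReal.ofReal_le_ofReal_iff (Real.exp_pos _).le).1 (hwin.trans
      (OrthogonalSubspaceGame.winProb_le P (by omega) hn hβ hγ hratio hm'.le S))
  rw [one_div, ← Real.exp_log hC, ← Real.exp_neg, Real.exp_le_exp] at hle
  linarith

theorem mainTheorem6 {Ω : Type*} [MeasurableSpace Ω] (P : Measure Ω) [IsProbabilityMeasure P]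
    (d n m M k : ℕ) (hd : 8 ≤ d) (hn1 : 1 ≤ n) (hn : n ≤ d) (C β γ : ℝ) (hC : 1 ≤ C)
    (hβ0 : 0 < β) (hβ1 : β ≤ 1) (hγ0 : 0 < γ) (hγ1 : γ ≤ 1)
    (hratio : 12 * Real.sqrt ((k : ℝ) * d / n) ≤ γ / β)
    (hk_upper : (k : ℝ) ≤ (n : ℝ) / 4)
    (hk_lower : 50 * C * (((M : ℝ) + 2) / n) * Real.log (Real.sqrt d / γ) ≤ k)
    (S : OrthogonalSubspaceGame.Strategy Ω d n m M k)
    (hwin : ENNReal.ofReal (1 / C) ≤ OrthogonalSubspaceGame.winProb P hn S β γ) :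
    (n : ℝ) / 2 ≤ m := by
  have hkn := OrthogonalSubspaceGame.four_mul_log_lt_of_le hd hC hγ0 hγ1 hn1 hk_lower
  have hsqrt := mul_le_mul_of_nonneg_left
    (OrthogonalSubspaceGame.sqrt_div_le_sqrt_mul_div (d := d) hC hkn) (by norm_num : (0 : ℝ) ≤ 12)
  exact mainTheorem6_general P hn (by positivity) hβ0 hγ0 (hsqrt.trans hratio) hkn S hwin
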